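/- Let $r\ge 5$ be odd and let $e_1,\dots,e_r$ be the standard basis of $\mathbb{R}^r$. Put $\Pi_+=\{e_i-e_j,\ e_i+e_j : 1\le i<j\le r\}$ and $\alpha_i=e_i-e_{i+1}$ $(1\le i\le r-1)$, $\alpha_r=e_{r-1}+e_r$; write $\rho\le\eta$ if $\eta-\rho\in\sum_{a=1}^r\mathbb{Z}_{\ge 0}\,\alpha_a$, and for $S\subseteq\Pi_+$ let $\mathrm{Adj}(S)=\{\gamma\in\Pi_+ : \gamma\le\beta \text{ for some } \beta\in S\}$. Let $W(D_r)$ be the group of signed permutations of $e_1,\dots,e_r$ with an even number of negative signs. For $u\in W(D_r)$ define $\nu_0(u)=u(\Pi_+)\cap\Pi_+$ and $\nu_k(u)=u(\mathrm{Adj}(\nu_{k-1}(u)))\cap\Pi_+$ for $k\ge 1$, and call $u$ rational if $\nu_k(u)=\varnothing$ for all sufficiently large $k$. For a non-empty $I=\{i_1<\cdots<i_k\}\subseteq\{1,\dots,r-1\}$ let $p_I\in S_r$ be the cycle $i_1\mapsto i_2\mapsto\cdots\mapsto i_k\mapsto r\mapsto i_1$, fixing all other points. Let $u\in W(D_r)$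 be given by $u(e_j)=\varepsilon_j e_{\pi(j)}$ with $\varepsilon_j\in\{\pm1\}$ and $\pi\in S_r$. Then $u$ is rational if and only if one of the following alternatives holds, and these alternatives are mutually exclusive: 1. $\pi=\mathrm{id}$ and $(\varepsilon_1,\dots,\varepsilon_r)=(-1,\dots,-1,+1)$; then $u=w_0$, where $w_0(e_j)=-e_j$ for $j\le r-1$ and $w_0(e_r)=e_r$. 2. There is a non-empty $I\subseteq\{1,\dots,r-1\}$ such that $\pi=p_I$, $\varepsilon_j=-1$ for $1\le j\le r-1$, and $\varepsilon_r=+1$; then $u=c_I$, where $c_I(e_j)=-e_{p_I(j)}$ for $j\le r-1$ and $c_I(e_r)=e_{p_I(r)}$. 3. There is a non-empty $I\subseteq\{1,\dots,r-1\}$ such that $\pi=p_I$, $\varepsilon_{\max I}=+1$, and $\varepsilon_j=-1$ for all $j\ne\max I$; then $u=d_I$, where $d_I(e_j)=-e_{p_I(j)}$ for $j\neq\max I$ and $d_I(e_{\max I})=e_r$. -/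

import Mathlib

namespace TypeD

/- Throughout, the rank is `r = n + 1`.  The coordinates `1, …, r` are the elements of `Fin (n + 1)`,
so the coordinate `r` is `Fin.last n`, and `{1, …, r - 1}` is `Fin n`, embedded by `Fin.castSucc`. -/

/-- The space `ℝ ^ r`. -/
abbrev V (n : ℕ) : Type := Fin (n + 1) → ℝ

/-- The standard basis vector `e_i`. -/
def e {n : ℕ} (i : Fin (n + 1)) : V n := Pi.single i 1

/-- The positive roots `e_i - e_j` and `e_i + e_j`, `i < j`. -/
def posRoots (n : ℕ) : Set (V n) :=
  {v | ∃ i j : Fin (n + 1), i < j ∧ (v = e i - e j ∨ v = e i + e j)}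

/-- The simple roots `e_i - e_{i+1}`, `1 ≤ i ≤ r - 1`, and `e_{r-1} + e_r`. -/
def simpleRoots (n : ℕ) : Set (V n) :=
  {v | ∃ i j : Fin (n + 1), i.val + 1 = j.val ∧ v = e i - e j} ∪
    {v | ∃ i j : Fin (n + 1), i.val + 1 = j.val ∧ j = Fin.last n ∧ v = e i + e j}

/-- The root order: `ρ ≤ η` iff `η - ρ` is a sum of simple roots with coefficients in `ℤ_{≥ 0}`. -/
def RootLE {n : ℕ} (ρ η : V n) : Prop :=
  η - ρ ∈ AddSubmonoid.closure (simpleRoots n)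

/-- `Adj S`: the positive roots that lie below some element of `S`. -/
def Adj {n : ℕ} (S : Set (V n)) : Set (V n) :=
  {γ | γ ∈ posRoots n ∧ ∃ β ∈ S, RootLE γ β}

/-- The signed permutation `e_j ↦ ε_j e_{π j}`. -/
def signedPerm {n : ℕ} (ε : Fin (n + 1) → ℤˣ) (π : Equiv.Perm (Fin (n + 1))) :
    V n ≃ₗ[ℝ] V n where
  toFun x := fun i => ε (π.symm i) • x (π.symm i)
  invFun y := fun j => ε j • y (π j)
  map_add' x y := by
    funext i
    simp
  map_smul' c x := by
    funext i
    exact smul_comm (ε (π.symm i)) c (x (π.symm i))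
  left_inv x := by
    funext j
    simp [smul_smul]
  right_inv y := by
    funext i
    simp [smul_smul]

theorem signedPerm_e {n : ℕ} (ε : Fin (n + 1) → ℤˣ) (π : Equiv.Perm (Fin (n + 1)))
    (j : Fin (n + 1)) : signedPerm ε π (e j) = ε j • e (π j) := by
  funext i
  by_cases h : i = π j
  · subst h
    simp [signedPerm, e]
  · have h' : π.symm i ≠ j := fun hc => h (by simp [← hc])
    simp [signedPerm, e, h, h']

theorem signedPerm_mul {n : ℕ} (ε δ : Fin (n + 1) → ℤˣ) (π σ : Equiv.Perm (Fin (n + 1))) :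
    signedPerm ε π * signedPerm δ σ = signedPerm (fun j => ε (σ j) * δ j) (π * σ) := by
  ext x i
  simp [signedPerm, smul_smul, Equiv.Perm.mul_def]

theorem signedPerm_one {n : ℕ} : signedPerm (fun _ : Fin (n + 1) => 1) 1 = 1 := by
  ext x i
  simp [signedPerm, Equiv.Perm.one_def]

theorem prod_signs {n : ℕ} (ε : Fin (n + 1) → ℤˣ) :
    ∏ j, ε j = (-1) ^ (Finset.univ.filter fun j => ε j = -1).card := by
  rw [← Finset.prod_const, Finset.prod_filter]
  refine Finset.prod_congr rfl fun j _ => ?_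
  rcases Int.units_eq_one_or (ε j) with h | h <;> simp [h]

theorem even_signs_iff {n : ℕ} (ε : Fin (n + 1) → ℤˣ) :
    Even (Finset.univ.filter fun j => ε j = -1).card ↔ ∏ j, ε j = 1 := by
  rw [prod_signs]
  rcases Nat.even_or_odd (Finset.univ.filter fun j => ε j = -1).card with h | h
  · simp [h]
  · simp [h.neg_one_pow, Nat.not_even_iff_odd.mpr h]

/-- The Weyl group `W(D_r)`: the signed permutations of the coordinates of `ℝ ^ r` with an even
number of negative signs. -/
def weylGroup (n : ℕ) : Subgroup (V n ≃ₗ[ℝ] V n) where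
  carrier := {u | ∃ (ε : Fin (n + 1) → ℤˣ) (π : Equiv.Perm (Fin (n + 1))),
    Even (Finset.univ.filter fun j => ε j = -1).card ∧ u = signedPerm ε π}
  mul_mem' := by
    rintro _ _ ⟨ε, π, hε, rfl⟩ ⟨δ, σ, hδ, rfl⟩
    refine ⟨_, _, ?_, signedPerm_mul ε δ π σ⟩
    rw [even_signs_iff] at *
    rw [Finset.prod_mul_distrib, hδ, Equiv.prod_comp σ ε, hε, one_mul]
  one_mem' := ⟨fun _ => 1, 1, by rw [even_signs_iff]; simp, signedPerm_one.symm⟩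
  inv_mem' := by
    rintro _ ⟨ε, π, hε, rfl⟩
    refine ⟨fun j => ε (π⁻¹ j), π⁻¹, ?_, ?_⟩
    · rw [even_signs_iff] at *
      rw [Equiv.prod_comp π⁻¹ ε, hε]
    · rw [inv_eq_iff_mul_eq_one, signedPerm_mul, ← signedPerm_one]
      congr 1
      · funext j
        simp
      · simp

/-- The sequence `ν_0(u) = u(Π₊) ∩ Π₊`, `ν_k(u) = u(Adj ν_{k-1}(u)) ∩ Π₊`. -/
def nu {n : ℕ} (u : weylGroup n) : ℕ → Set (V n)
  | 0 => u.1 '' posRoots n ∩ posRoots n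
  | k + 1 => u.1 '' Adj (nu u k) ∩ posRoots n

/-- `u` is rational if `ν_k(u)` is empty for all sufficiently large `k`. -/
def IsRational {n : ℕ} (u : weylGroup n) : Prop :=
  ∃ K : ℕ, ∀ k ≥ K, nu u k = ∅

/-- For `I = {i_1 < ⋯ < i_k} ⊆ {1, …, r - 1}`, the cycle `p_I = (i_1 i_2 ⋯ i_k r)`, with
`i_1 ↦ i_2 ↦ ⋯ ↦ i_k ↦ r ↦ i_1`. -/
def cyc {n : ℕ} (I : Finset (Fin n)) : Equiv.Perm (Fin (n + 1)) :=
  ((I.sort (· ≤ ·)).map Fin.castSucc ++ [Fin.last n]).formPerm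

/-- The sign vector whose only positive entry is at position `m`. -/
def signsAt {n : ℕ} (m : Fin (n + 1)) : Fin (n + 1) → ℤˣ :=
  fun j => if j = m then 1 else -1

/-- The element `w_0`: `e_j ↦ -e_j` for `j ≤ r - 1` and `e_r ↦ e_r` (for `r` odd this is the longest
element of `W(D_r)`). -/
def w0 (n : ℕ) : V n ≃ₗ[ℝ] V n := signedPerm (signsAt (Fin.last n)) 1

/-- The element `c_I`: `e_j ↦ -e_{p_I(j)}` for `j ≤ r - 1` and `e_r ↦ e_{p_I(r)}`. -/
def cElt {n : ℕ} (I : Finset (Fin n)) : V n ≃ₗ[ℝ] V n :=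
  signedPerm (signsAt (Fin.last n)) (cyc I)

/-- The element `d_I`: `e_j ↦ -e_{p_I(j)}` for `j ≠ max I` and `e_{max I} ↦ e_{p_I(max I)} = e_r`. -/
def dElt {n : ℕ} (I : Finset (Fin n)) (hI : I.Nonempty) : V n ≃ₗ[ℝ] V n :=
  signedPerm (signsAt (I.max' hI).castSucc) (cyc I)

/-- First alternative: `π = id` and the signs are `(-1, …, -1, +1)`. -/
def AltW {n : ℕ} (ε : Fin (n + 1) → ℤˣ) (π : Equiv.Perm (Fin (n + 1))) : Prop :=
  π = 1 ∧ (∀ j : Fin n, ε j.castSucc = -1) ∧ ε (Fin.last n) = 1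

/-- Second alternative, for a given `I`: `π = p_I`, `ε_j = -1` for `j ≤ r - 1`, and `ε_r = +1`. -/
def AltC {n : ℕ} (ε : Fin (n + 1) → ℤˣ) (π : Equiv.Perm (Fin (n + 1))) (I : Finset (Fin n)) :
    Prop :=
  π = cyc I ∧ (∀ j : Fin n, ε j.castSucc = -1) ∧ ε (Fin.last n) = 1

/-- Third alternative, for a given non-empty `I`: `π = p_I`, `ε_{max I} = +1`, and `ε_j = -1` for
`j ≠ max I`. -/
def AltD {n : ℕ} (ε : Fin (n + 1) → ℤˣ) (π : Equiv.Perm (Fin (n + 1))) (I : Finset (Fin n))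
    (hI : I.Nonempty) : Prop :=
  π = cyc I ∧ ε (I.max' hI).castSucc = 1 ∧ ∀ j, j ≠ (I.max' hI).castSucc → ε j = -1

end TypeD

/-!
If `γ` and `δ` are positive roots with positive images and `γ ≤ u δ`, `δ ≤ u γ`, then `u γ` and
`u δ` lie in every `ν_k(u)`. When `ε_r = 1` or `π(r) = r`, excluding such pairs among the roots
`e_i ± e_j` forces `ε_j = -1` for all `j < r` and `k ≤ π(k)` whenever `ε_k = -1`. Conversely, under
these two conditions every element of `ν_k(u)` has the form `e_a - e_b`, and since `π` raises
indices, the smallest `a` occurring grows with `k`, so that `ν_k(u)` dies out. The remaining case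
`ε_r = -1`, `π(r) ≠ r` is conjugate to one with `ε_r = 1` under the diagram automorphism
`e_r ↦ -e_r`.

A permutation with `k ≤ π(k)` for all `k < r` is determined by the set `I` of those `k < r` that it
moves; since `p_I` is such a permutation, `π = p_I`. If all signs are negative, the same inequality
for `k = r` leaves only `u = -1`, which is not in `W(D_r)` when `r` is odd.
-/

namespace TypeD

open Finset

variable {n : ℕ}

/-! ### The root order -/

theorem sub_mem_posRoots {i j : Fin (n + 1)} (h : i < j) : e i - e j ∈ posRoots n :=
  ⟨i, j, h, Or.inl rfl⟩

theorem add_mem_posRoots {i j : Fin (n + 1)} (h : i ≠ j) : e i + e j ∈ posRoots n := by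
  rcases h.lt_or_gt with h | h
  · exact ⟨i, j, h, Or.inr rfl⟩
  · exact ⟨j, i, h, Or.inr (add_comm _ _)⟩

theorem sub_mem_closure {i j : Fin (n + 1)} (h : i ≤ j) :
    (e i - e j : V n) ∈ AddSubmonoid.closure (simpleRoots n) := by
  induction j using Fin.induction with
  | zero => simp [Fin.le_zero_iff.1 h]
  | succ j ih =>
    rcases h.eq_or_lt with rfl | hlt
    · simp
    · have hsimple : (e j.castSucc - e j.succ : V n) ∈ simpleRoots n :=
        Or.inl ⟨_, _, by simp, rfl⟩
      simpa using add_mem (ih (Fin.le_castSucc_iff.2 hlt)) (AddSubmonoid.subset_closure hsimple)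

theorem add_mem_closure_of_lt {i j : Fin (n + 1)} (h : i < j) :
    (e i + e j : V n) ∈ AddSubmonoid.closure (simpleRoots n) := by
  obtain ⟨p, hp⟩ : ∃ p : Fin (n + 1), p.val + 1 = n := ⟨⟨n - 1, by omega⟩, by simp; omega⟩
  have hip : i ≤ p := by rw [Fin.le_def]; omega
  have hsimple : (e p + e (Fin.last n) : V n) ∈ simpleRoots n := Or.inr ⟨p, _, hp, rfl, rfl⟩
  have hsum : (e i + e j : V n) =
      (e i - e p) + (e j - e (Fin.last n)) + (e p + e (Fin.last n)) := by abel
  rw [hsum]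
  exact add_mem (add_mem (sub_mem_closure hip) (sub_mem_closure (Fin.le_last j)))
    (AddSubmonoid.subset_closure hsimple)

theorem add_mem_closure {i j : Fin (n + 1)} (h : j ≠ i ∨ j ≠ Fin.last n) :
    (e i + e j : V n) ∈ AddSubmonoid.closure (simpleRoots n) := by
  rcases lt_trichotomy i j with hij | rfl | hij
  · exact add_mem_closure_of_lt hij
  · have hi : i < Fin.last n := Fin.lt_last_iff_ne_last.2 (by simpa using h)
    have hsum : (e i + e i : V n) = (e i - e (Fin.last n)) + (e i + e (Fin.last n)) := by abel
    rw [hsum]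
    exact add_mem (sub_mem_closure hi.le) (add_mem_closure_of_lt hi)
  · simpa only [add_comm] using add_mem_closure_of_lt hij

theorem rootLE_sub_sub {i k a b : Fin (n + 1)} (ha : a ≤ i) (hb : k ≤ b) :
    RootLE (e i - e k) (e a - e b) := by
  rw [RootLE, show (e a - e b - (e i - e k) : V n) = (e a - e i) + (e k - e b) by abel]
  exact add_mem (sub_mem_closure ha) (sub_mem_closure hb)

theorem rootLE_add_add {i k a b : Fin (n + 1)} (ha : a ≤ i) (hb : b ≤ k) :
    RootLE (e i + e k) (e a + e b) := by
  rw [RootLE, show (e a + e b - (e i + e k) : V n) = (e a - e i) + (e b - e k) by abel]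
  exact add_mem (sub_mem_closure ha) (sub_mem_closure hb)

theorem rootLE_sub_add {i k a b : Fin (n + 1)} (ha : a ≤ i) (hk : k ≠ b ∨ k ≠ Fin.last n) :
    RootLE (e i - e k) (e a + e b) := by
  rw [RootLE, show (e a + e b - (e i - e k) : V n) = (e a - e i) + (e b + e k) by abel]
  exact add_mem (sub_mem_closure ha) (add_mem_closure hk)

theorem sum_e (s : Finset (Fin (n + 1))) (i : Fin (n + 1)) :
    ∑ j ∈ s, (e i : V n) j = if i ∈ s then 1 else 0 := by
  simp [e, Pi.single_apply]

theorem sum_Iic_nonneg_of_mem_simpleRoots {α : V n} (h : α ∈ simpleRoots n) (t : Fin (n + 1)) :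
    0 ≤ ∑ j ∈ Iic t, α j := by
  rcases h with ⟨i, j, hij, rfl⟩ | ⟨i, j, -, -, rfl⟩
  · have hle : j ≤ t → i ≤ t := (show i ≤ j by rw [Fin.le_def]; omega).trans
    simp only [Pi.sub_apply, sum_sub_distrib, sum_e, mem_Iic]
    split_ifs <;> simp_all
  · simp only [Pi.add_apply, sum_add_distrib, sum_e]
    split_ifs <;> norm_num

theorem RootLE.sum_Iic_le {ρ η : V n} (h : RootLE ρ η) (t : Fin (n + 1)) :
    ∑ j ∈ Iic t, ρ j ≤ ∑ j ∈ Iic t, η j := by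
  suffices key : ∀ v ∈ AddSubmonoid.closure (simpleRoots n), 0 ≤ ∑ j ∈ Iic t, v j by
    simpa [sum_sub_distrib] using key _ h
  intro v hv
  induction hv using AddSubmonoid.closure_induction with
  | mem α hα => exact sum_Iic_nonneg_of_mem_simpleRoots hα t
  | zero => simp
  | add x y _ _ hx hy => simpa [sum_add_distrib] using add_nonneg hx hy

theorem RootLE.sum_le {ρ η : V n} (h : RootLE ρ η) : ∑ j, ρ j ≤ ∑ j, η j := by
  simpa [← Fin.top_eq_last, Iic_top] using h.sum_Iic_le (Fin.last n)

theorem not_rootLE_add_sub (i k a b : Fin (n + 1)) : ¬ RootLE (e i + e k) (e a - e b) := by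
  intro h
  have hsum := h.sum_le
  simp only [Pi.add_apply, Pi.sub_apply, sum_add_distrib, sum_sub_distrib, sum_e, mem_univ,
    if_true] at hsum
  norm_num at hsum

theorem RootLE.le_of_sub_sub {i k a b : Fin (n + 1)} (hik : i < k)
    (h : RootLE (e i - e k) (e a - e b)) : a ≤ i := by
  by_contra hai
  have hsum := h.sum_Iic_le i
  simp only [Pi.sub_apply, sum_sub_distrib, sum_e, mem_Iic, le_refl, if_true,
    hik.not_ge, hai, if_false] at hsum
  split_ifs at hsum <;> norm_num at hsum

theorem neg_sub_notMem_posRoots (i j : Fin (n + 1)) : (-e i - e j : V n) ∉ posRoots n := by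
  rintro ⟨a, b, -, h⟩
  rcases h with h | h <;> have hsum := congrArg (fun v : V n => ∑ t, v t) h <;>
    simp only [Pi.add_apply, Pi.sub_apply, Pi.neg_apply, sum_add_distrib, sum_sub_distrib,
      sum_neg_distrib, sum_e, mem_univ, if_true] at hsum <;>
    norm_num at hsum

/-! ### The iteration for an arbitrary map -/

/-- The sequence `ν_k` attached to an arbitrary self-map of `ℝ ^ r`, so that it makes sense for
signed permutations with an odd number of signs and for conjugates of `u` by maps outside the
Weyl group. -/
def nuSeq (u : V n → V n) : ℕ → Set (V n)
  | 0 => u '' posRoots n ∩ posRoots n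
  | k + 1 => u '' Adj (nuSeq u k) ∩ posRoots n

/-- Rationality of an arbitrary self-map of `ℝ ^ r`: the sets `ν_k` are eventually empty. -/
def NuVanishes (u : V n → V n) : Prop :=
  ∃ K : ℕ, ∀ k ≥ K, nuSeq u k = ∅

theorem nu_eq_nuSeq (u : weylGroup n) (k : ℕ) : nu u k = nuSeq u.1 k := by
  induction k with
  | zero => rfl
  | succ k ih => simp only [nu, nuSeq, ih]

theorem isRational_iff_nuVanishes (u : weylGroup n) : IsRational u ↔ NuVanishes u.1 := by
  simp only [IsRational, NuVanishes, nu_eq_nuSeq]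

theorem Adj_mono {S T : Set (V n)} (h : S ⊆ T) : Adj S ⊆ Adj T :=
  fun _ ⟨hpos, β, hβ, hle⟩ => ⟨hpos, β, h hβ, hle⟩

theorem subset_nuSeq {u : V n → V n} {T : Set (V n)} (hpos : T ⊆ posRoots n)
    (hT : T ⊆ u '' Adj T) (k : ℕ) : T ⊆ nuSeq u k := by
  induction k with
  | zero => exact Set.subset_inter (hT.trans (Set.image_mono fun _ h => h.1)) hpos
  | succ k ih => exact Set.subset_inter (hT.trans (Set.image_mono (Adj_mono ih))) hpos

theorem NuVanishes.not_cycle {u : V n → V n} (hu : NuVanishes u) {γ δ : V n}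
    (hγ : γ ∈ posRoots n) (hδ : δ ∈ posRoots n) (huγ : u γ ∈ posRoots n)
    (huδ : u δ ∈ posRoots n) (hγδ : RootLE γ (u δ)) : ¬ RootLE δ (u γ) := by
  intro hδγ
  obtain ⟨K, hK⟩ := hu
  have hsub : {u γ, u δ} ⊆ nuSeq u K := by
    refine subset_nuSeq (Set.pair_subset huγ huδ) (Set.pair_subset ?_ ?_) K
    · exact ⟨γ, ⟨hγ, u δ, by simp, hγδ⟩, rfl⟩
    · exact ⟨δ, ⟨hδ, u γ, by simp, hδγ⟩, rfl⟩
  rw [hK K le_rfl] at hsub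
  exact hsub (Set.mem_insert _ _)

theorem NuVanishes.not_rootLE {u : V n → V n} (hu : NuVanishes u) {γ : V n}
    (hγ : γ ∈ posRoots n) (huγ : u γ ∈ posRoots n) : ¬ RootLE γ (u γ) :=
  fun h => hu.not_cycle hγ hγ huγ huγ h h

section Conjugation

variable {s : V n ≃ₗ[ℝ] V n}

theorem rootLE_map_iff (hs : s '' simpleRoots n = simpleRoots n) {ρ η : V n} :
    RootLE (s ρ) (s η) ↔ RootLE ρ η := by
  rw [RootLE, ← map_sub, ← hs, ← AddMonoidHom.map_mclosure]
  exact AddSubmonoid.mem_map_iff_mem s.injective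

theorem image_Adj (hs : s '' simpleRoots n = simpleRoots n)
    (hpos : s '' posRoots n = posRoots n) (S : Set (V n)) : s '' Adj S = Adj (s '' S) := by
  ext x
  obtain ⟨y, rfl⟩ := s.surjective x
  have hy : s y ∈ posRoots n ↔ y ∈ posRoots n := by
    conv_lhs => rw [← hpos]
    exact s.injective.mem_set_image
  rw [s.injective.mem_set_image]
  simp [Adj, hy, rootLE_map_iff hs]

theorem nuSeq_semiconj (hs : s '' simpleRoots n = simpleRoots n)
    (hpos : s '' posRoots n = posRoots n) {u w : V n → V n} (h : Function.Semiconj s u w) (k : ℕ) :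
    s '' nuSeq u k = nuSeq w k := by
  induction k with
  | zero => rw [nuSeq, nuSeq, Set.image_inter s.injective, h.set_image, hpos]
  | succ k ih =>
    rw [nuSeq, nuSeq, Set.image_inter s.injective, h.set_image, image_Adj hs hpos, ih, hpos]

theorem nuVanishes_iff_of_semiconj (hs : s '' simpleRoots n = simpleRoots n)
    (hpos : s '' posRoots n = posRoots n) {u w : V n → V n} (h : Function.Semiconj s u w) :
    NuVanishes u ↔ NuVanishes w := by
  simp only [NuVanishes, ← nuSeq_semiconj hs hpos h, Set.image_eq_empty]

end Conjugation

/-! ### The diagram automorphism -/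

/-- The sign vector of the diagram automorphism: its only negative entry is the last one. -/
def lastSign (j : Fin (n + 1)) : ℤˣ := if j = Fin.last n then -1 else 1

/-- The diagram automorphism of `D_r`, which interchanges the simple roots `e_{r-1} - e_r` and
`e_{r-1} + e_r`: the reflection in the last coordinate. -/
def flipLast (n : ℕ) : V n ≃ₗ[ℝ] V n := signedPerm lastSign 1

theorem flipLast_e_last : flipLast n (e (Fin.last n)) = -e (Fin.last n) := by
  simp [flipLast, signedPerm_e, lastSign]

theorem flipLast_e {j : Fin (n + 1)} (hj : j ≠ Fin.last n) : flipLast n (e j) = e j := by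
  simp [flipLast, signedPerm_e, lastSign, hj]

theorem flipLast_involutive : Function.Involutive (flipLast n) := by
  have h : flipLast n * flipLast n = 1 := by
    rw [flipLast, signedPerm_mul, ← signedPerm_one]
    simp [Int.units_mul_self]
  exact DFunLike.congr_fun h

theorem flipLast_mem_posRoots {x : V n} (h : x ∈ posRoots n) : flipLast n x ∈ posRoots n := by
  obtain ⟨i, j, hij, h⟩ := h
  have hi : i ≠ Fin.last n := Fin.ne_last_of_lt hij
  refine ⟨i, j, hij, ?_⟩
  by_cases hj : j = Fin.last n
  · subst hj
    rcases h with rfl | rfl <;> simp [flipLast_e hi, flipLast_e_last, sub_eq_add_neg]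
  · rcases h with rfl | rfl <;> simp [flipLast_e hi, flipLast_e hj]

theorem flipLast_mem_simpleRoots {x : V n} (h : x ∈ simpleRoots n) :
    flipLast n x ∈ simpleRoots n := by
  have hne {i j : Fin (n + 1)} (hij : i.val + 1 = j.val) : i ≠ Fin.last n :=
    Fin.ne_last_of_lt (show i < j by rw [Fin.lt_def]; omega)
  rcases h with ⟨i, j, hij, rfl⟩ | ⟨i, _, hij, rfl, rfl⟩
  · by_cases hj : j = Fin.last n
    · subst hj
      exact Or.inr ⟨i, _, hij, rfl, by simp [flipLast_e (hne hij), flipLast_e_last]⟩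
    · exact Or.inl ⟨i, j, hij, by simp [flipLast_e (hne hij), flipLast_e hj]⟩
  · exact Or.inl ⟨i, _, hij, by simp [flipLast_e (hne hij), flipLast_e_last, sub_eq_add_neg]⟩

theorem flipLast_image_eq {S : Set (V n)} (h : Set.MapsTo (flipLast n) S S) :
    flipLast n '' S = S :=
  h.image_subset.antisymm fun x hx => ⟨_, h hx, flipLast_involutive x⟩

/-- The effect on the sign vector of conjugating `signedPerm ε π` by the diagram automorphism. -/
def flipSigns (π : Equiv.Perm (Fin (n + 1))) (ε : Fin (n + 1) → ℤˣ) : Fin (n + 1) → ℤˣ :=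
  fun j => lastSign (π j) * ε j * lastSign j

theorem flipSigns_involutive (π : Equiv.Perm (Fin (n + 1))) :
    Function.Involutive (flipSigns π) := by
  intro ε
  funext j
  calc lastSign (π j) * (lastSign (π j) * ε j * lastSign j) * lastSign j
      = (lastSign (π j) * lastSign (π j)) * ε j * (lastSign j * lastSign j) := by
        simp only [mul_assoc]
    _ = ε j := by simp only [Int.units_mul_self, one_mul, mul_one]

theorem flipSigns_signsAt_last (π : Equiv.Perm (Fin (n + 1))) :
    flipSigns π (signsAt (Fin.last n)) = signsAt (π.symm (Fin.last n)) := by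
  funext j
  simp only [flipSigns, lastSign, signsAt, Equiv.eq_symm_apply]
  split_ifs <;> rfl

theorem nuVanishes_flipSigns_iff {ε : Fin (n + 1) → ℤˣ} {π : Equiv.Perm (Fin (n + 1))} :
    NuVanishes (signedPerm (flipSigns π ε) π) ↔ NuVanishes (signedPerm ε π) := by
  have hmul : signedPerm (flipSigns π ε) π * flipLast n = flipLast n * signedPerm ε π := by
    rw [flipLast, signedPerm_mul, signedPerm_mul]
    simp [flipSigns, mul_assoc, Int.units_mul_self]
  exact (nuVanishes_iff_of_semiconj
    (flipLast_image_eq fun _ => flipLast_mem_simpleRoots)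
    (flipLast_image_eq fun _ => flipLast_mem_posRoots)
    fun x => (DFunLike.congr_fun hmul x).symm).symm

/-! ### Rational signed permutations -/

section Criterion

variable {ε : Fin (n + 1) → ℤˣ} {π : Equiv.Perm (Fin (n + 1))}

theorem exists_ge_apply_le (π : Equiv.Perm (Fin (n + 1))) (i : Fin (n + 1)) :
    ∃ k, i ≤ k ∧ π k ≤ i := by
  by_contra! h
  have hcard : (Ici i).card ≤ (Ioi i).card :=
    card_le_card_of_injOn π (by simpa [Set.MapsTo] using h) π.injective.injOn
  rw [Fin.card_Ici, Fin.card_Ioi] at hcard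
  omega

theorem NuVanishes.lt_apply_of_pos_neg (hu : NuVanishes (signedPerm ε π)) {i k : Fin (n + 1)}
    (hik : i < k) (hk : k ≠ Fin.last n) (hεi : ε i = 1) (hεk : ε k = -1) : i < π k := by
  by_contra! hle
  have himg : signedPerm ε π (e i - e k) = e (π k) + e (π i) := by
    simp [signedPerm_e, hεi, hεk, add_comm]
  refine hu.not_rootLE (sub_mem_posRoots hik) ?_ ?_ <;> rw [himg]
  · exact add_mem_posRoots (π.injective.ne hik.ne')
  · exact rootLE_sub_add hle (Or.inr hk)

theorem NuVanishes.lt_apply_of_pos_last (hu : NuVanishes (signedPerm ε π)) {i : Fin (n + 1)}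
    (hi : i ≠ Fin.last n) (hεi : ε i = 1) (hl : ε (Fin.last n) = 1) :
    i < π i ∧ i < π (Fin.last n) := by
  have himg : signedPerm ε π (e i + e (Fin.last n)) = e (π i) + e (π (Fin.last n)) := by
    simp [signedPerm_e, hεi, hl]
  have hnot := hu.not_rootLE (add_mem_posRoots hi)
    (by rw [himg]; exact add_mem_posRoots (π.injective.ne hi))
  rw [himg] at hnot
  refine ⟨?_, ?_⟩ <;> by_contra! hle
  · exact hnot (rootLE_add_add hle (Fin.le_last _))
  · rw [add_comm (e (π i))] at hnot
    exact hnot (rootLE_add_add hle (Fin.le_last _))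

theorem NuVanishes.lt_apply_of_pos_of_neg_last (hu : NuVanishes (signedPerm ε π))
    {i : Fin (n + 1)} (hi : i ≠ Fin.last n) (hεi : ε i = 1) (hl : ε (Fin.last n) = -1)
    (hπl : π (Fin.last n) = Fin.last n) : i < π i := by
  by_contra! hle
  have hil : i < Fin.last n := Fin.lt_last_iff_ne_last.2 hi
  have hsub : signedPerm ε π (e i - e (Fin.last n)) = e (π i) + e (Fin.last n) := by
    simp [signedPerm_e, hεi, hl, hπl]
  have hadd : signedPerm ε π (e i + e (Fin.last n)) = e (π i) - e (Fin.last n) := by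
    simp [signedPerm_e, hεi, hl, hπl, sub_eq_add_neg]
  refine hu.not_cycle (sub_mem_posRoots hil) (add_mem_posRoots hi) ?_ ?_ ?_ ?_
  · rw [hsub]
    exact add_mem_posRoots (hle.trans_lt hil).ne
  · rw [hadd]
    exact sub_mem_posRoots (hle.trans_lt hil)
  · rw [hadd]
    exact rootLE_sub_sub hle le_rfl
  · rw [hsub]
    exact rootLE_add_add hle le_rfl

theorem NuVanishes.apply_lt_of_neg_neg (hu : NuVanishes (signedPerm ε π)) {i k : Fin (n + 1)}
    (hik : i < k) (hεi : ε i = -1) (hεk : ε k = -1) (hle : π k ≤ i) : π i < k := by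
  by_contra! hge
  have himg : signedPerm ε π (e i - e k) = e (π k) - e (π i) := by
    simp [signedPerm_e, hεi, hεk, sub_eq_add_neg, add_comm]
  refine hu.not_rootLE (sub_mem_posRoots hik) ?_ ?_ <;> rw [himg]
  · exact sub_mem_posRoots (hle.trans_lt (hik.trans_le hge))
  · exact rootLE_sub_sub hle hge

theorem NuVanishes.eq_neg_one_of_ne_last (hu : NuVanishes (signedPerm ε π))
    (hl : ε (Fin.last n) = 1 ∨ π (Fin.last n) = Fin.last n) {k : Fin (n + 1)}
    (hk : k ≠ Fin.last n) : ε k = -1 := by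
  by_contra hεk
  obtain ⟨i, hi, hmax⟩ := exists_max_image {j | j ≠ Fin.last n ∧ ε j = 1} id
    ⟨k, by simpa using ⟨hk, (Int.units_eq_one_or _).resolve_right hεk⟩⟩
  simp only [mem_filter, mem_univ, true_and, id] at hi hmax
  have hlt : i < π i ∧ i < π (Fin.last n) := by
    rcases Int.units_eq_one_or (ε (Fin.last n)) with hpos | hneg
    · exact hu.lt_apply_of_pos_last hi.1 hi.2 hpos
    · have hπl := hl.resolve_left (by simp [hneg])
      exact ⟨hu.lt_apply_of_pos_of_neg_last hi.1 hi.2 hneg hπl,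
        (Fin.lt_last_iff_ne_last.2 hi.1).trans_eq hπl.symm⟩
  obtain ⟨m, him, hm⟩ := exists_ge_apply_le π i
  rcases him.eq_or_lt with rfl | him
  · exact hm.not_gt hlt.1
  by_cases hml : m = Fin.last n
  · exact hm.not_gt (hml ▸ hlt.2)
  · have hεm : ε m = -1 :=
      (Int.units_eq_one_or _).resolve_left fun h => him.not_ge (hmax m ⟨hml, h⟩)
    exact hm.not_gt (hu.lt_apply_of_pos_neg him hml hi.2 hεm)

theorem NuVanishes.le_apply_of_neg (hu : NuVanishes (signedPerm ε π)) {k : Fin (n + 1)}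
    (hneg : ∀ j ≤ k, ε j = -1) : k ≤ π k := by
  induction k using WellFoundedLT.induction with
  | ind k ih =>
    by_contra! hlt
    have hmaps : Set.MapsTo π (Ico (π k) k) (Ioo (π k) k) := by
      intro i hi
      obtain ⟨hki, hik⟩ := mem_Ico.1 hi
      have hiπ : i ≤ π i := ih i hik fun j hj => hneg j (hj.trans hik.le)
      exact mem_Ioo.2 ⟨(hki.trans hiπ).lt_of_ne (π.injective.ne hik.ne'),
        hu.apply_lt_of_neg_neg hik (hneg i hik.le) (hneg k le_rfl) hki⟩
    have hcard := card_le_card_of_injOn π hmaps π.injective.injOn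
    rw [Fin.card_Ico, Fin.card_Ioo] at hcard
    have : (π k).val < k.val := hlt
    omega

theorem signedPerm_sub_of_mem_posRoots {i j : Fin (n + 1)} (hi : ε i = -1)
    (h : signedPerm ε π (e i - e j) ∈ posRoots n) :
    ε j = -1 ∧ signedPerm ε π (e i - e j) = e (π j) - e (π i) := by
  rcases Int.units_eq_one_or (ε j) with hj | hj
  · refine absurd h ?_
    simpa [signedPerm_e, hi, hj] using neg_sub_notMem_posRoots (π i) (π j)
  · exact ⟨hj, by simp [signedPerm_e, hi, hj, sub_eq_add_neg, add_comm]⟩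

theorem signedPerm_add_of_mem_posRoots {i j : Fin (n + 1)} (hi : ε i = -1)
    (h : signedPerm ε π (e i + e j) ∈ posRoots n) :
    signedPerm ε π (e i + e j) = e (π j) - e (π i) := by
  rcases Int.units_eq_one_or (ε j) with hj | hj
  · simp [signedPerm_e, hi, hj, sub_eq_add_neg, add_comm]
  · refine absurd h ?_
    simpa [signedPerm_e, hi, hj, sub_eq_add_neg] using neg_sub_notMem_posRoots (π i) (π j)

theorem nuSeq_subset (hneg : ∀ k, k ≠ Fin.last n → ε k = -1) (hle : ∀ k, ε k = -1 → k ≤ π k)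
    (k : ℕ) : nuSeq (signedPerm ε π) k ⊆ {v | ∃ a b : Fin (n + 1), k ≤ a.val ∧ v = e a - e b} := by
  have hεi {i j : Fin (n + 1)} (hij : i < j) : ε i = -1 := hneg i (Fin.ne_last_of_lt hij)
  induction k with
  | zero =>
    rintro _ ⟨⟨_, ⟨i, j, hij, rfl | rfl⟩, rfl⟩, hpos⟩
    · exact ⟨π j, π i, Nat.zero_le _, (signedPerm_sub_of_mem_posRoots (hεi hij) hpos).2⟩
    · exact ⟨π j, π i, Nat.zero_le _, signedPerm_add_of_mem_posRoots (hεi hij) hpos⟩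
  | succ k ih =>
    rintro _ ⟨⟨_, ⟨⟨i, j, hij, rfl | rfl⟩, β, hβ, hroot⟩, rfl⟩, hpos⟩ <;>
      obtain ⟨a, b, hka, rfl⟩ := ih hβ
    · obtain ⟨hj, himg⟩ := signedPerm_sub_of_mem_posRoots (hεi hij) hpos
      have hlt : a < π j := (hroot.le_of_sub_sub hij).trans_lt (hij.trans_le (hle j hj))
      exact ⟨π j, π i, hka.trans_lt hlt, himg⟩
    · exact absurd hroot (not_rootLE_add_sub i j a b)

theorem nuVanishes_signedPerm (hneg : ∀ k, k ≠ Fin.last n → ε k = -1)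
    (hle : ∀ k, ε k = -1 → k ≤ π k) : NuVanishes (signedPerm ε π) := by
  refine ⟨n + 1, fun k hk => Set.eq_empty_of_forall_notMem fun v hv => ?_⟩
  obtain ⟨a, -, ha, -⟩ := nuSeq_subset hneg hle k hv
  omega

end Criterion

/-! ### The permutations `p_I` -/

/-- The permutations `π` with `k ≤ π(k)` for all `k < r`. They turn out to be the cycles `p_I`,
together with the identity. -/
def WeaklyRaising (π : Equiv.Perm (Fin (n + 1))) : Prop :=
  ∀ k, k ≠ Fin.last n → k ≤ π k

theorem WeaklyRaising.image_Ico {π : Equiv.Perm (Fin (n + 1))} (hπ : WeaklyRaising π)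
    {k : Fin (n + 1)} (hk : k ≠ Fin.last n) (hπk : π k ≠ k) :
    (Ico k (Fin.last n)).image π = Ioi k := by
  refine eq_of_subset_of_card_le (image_subset_iff.2 fun x hx => mem_Ioi.2 ?_) ?_
  · obtain ⟨hkx, hxl⟩ := mem_Ico.1 hx
    rcases hkx.eq_or_lt with rfl | hlt
    · exact (hπ k hk).lt_of_ne hπk.symm
    · exact hlt.trans_le (hπ x hxl.ne)
  · rw [card_image_of_injective _ π.injective, Fin.card_Ico, Fin.card_Ioi]
    simp

theorem perm_eq_of_eqOn_ne {α : Type*} {π σ : Equiv.Perm α} (a : α)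
    (h : ∀ x, x ≠ a → π x = σ x) : π = σ := by
  ext x
  rcases eq_or_ne x a with rfl | hx
  · obtain ⟨y, hy⟩ := π.surjective (σ x)
    rcases eq_or_ne y x with rfl | hyx
    · exact hy
    · exact absurd (σ.injective ((h y hyx).symm.trans hy)) hyx
  · exact h x hx

theorem WeaklyRaising.eq_of_fixed_iff {π σ : Equiv.Perm (Fin (n + 1))} (hπ : WeaklyRaising π)
    (hσ : WeaklyRaising σ) (h : ∀ k, k ≠ Fin.last n → (π k = k ↔ σ k = k)) : π = σ := by
  refine perm_eq_of_eqOn_ne (Fin.last n) fun k => ?_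
  induction k using WellFoundedGT.induction with
  | ind k ih =>
    intro hk
    by_cases hfix : π k = k
    · rw [hfix, (h k hk).1 hfix]
    -- `σ k > k` is attained by `π` on `[k, r)`, and above `k` the two permutations agree.
    have hσk : σ k ∈ (Ico k (Fin.last n)).image π := by
      rw [hπ.image_Ico hk hfix, mem_Ioi]
      exact (hσ k hk).lt_of_ne fun hc => hfix ((h k hk).2 hc.symm)
    obtain ⟨x, hx, hxk⟩ := mem_image.1 hσk
    obtain ⟨hkx, hxl⟩ := mem_Ico.1 hx
    rcases hkx.eq_or_lt with rfl | hlt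
    · exact hxk
    · rw [ih x hlt hxl.ne] at hxk
      exact absurd (σ.injective hxk) hlt.ne'

theorem le_formPerm_append_singleton {α : Type*} [Preorder α] [DecidableEq α] {l : List α}
    {a x : α} (hl : (l ++ [a]).Pairwise (· < ·)) (hx : x ≠ a) : x ≤ (l ++ [a]).formPerm x := by
  by_cases hmem : x ∈ l ++ [a]
  · have hxl : x ∈ l := by simpa [hx] using hmem
    obtain ⟨m, hm, rfl⟩ := List.getElem_of_mem hxl
    have hm' : m + 1 < (l ++ [a]).length := by simpa using hm
    have hnext := List.formPerm_apply_lt_getElem _ (hl.imp ne_of_lt) m hm'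
    have hlt := List.pairwise_iff_getElem.1 hl m (m + 1) (m.lt_succ_self.trans hm') hm'
      m.lt_succ_self
    rw [List.getElem_append_left hm] at hnext hlt
    exact hlt.le.trans_eq hnext.symm
  · exact (List.formPerm_apply_of_notMem hmem).ge

/-- The list `i_1, …, i_k, r` of which `p_I` is the cycle. -/
def cycList (I : Finset (Fin n)) : List (Fin (n + 1)) :=
  (I.sort (· ≤ ·)).map Fin.castSucc ++ [Fin.last n]

theorem pairwise_lt_cycList (I : Finset (Fin n)) : (cycList I).Pairwise (· < ·) := by
  rw [cycList, List.pairwise_append, List.pairwise_map]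
  exact ⟨I.sortedLT_sort.pairwise.imp Fin.castSucc_lt_castSucc_iff.2, by simp,
    by simp [Fin.castSucc_lt_last]⟩

theorem castSucc_mem_cycList {I : Finset (Fin n)} {k : Fin n} : k.castSucc ∈ cycList I ↔ k ∈ I := by
  simp [cycList, Fin.castSucc_ne_last]

theorem weaklyRaising_cyc (I : Finset (Fin n)) : WeaklyRaising (cyc I) :=
  fun _ hk => le_formPerm_append_singleton (pairwise_lt_cycList I) hk

theorem cyc_castSucc_eq_self_iff (I : Finset (Fin n)) (k : Fin n) :
    cyc I k.castSucc = k.castSucc ↔ k ∉ I := by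
  refine ⟨fun h hk => ?_, fun hk => List.formPerm_apply_of_notMem (mt castSucc_mem_cycList.1 hk)⟩
  have hmem : k.castSucc ∈ cycList I := castSucc_mem_cycList.2 hk
  have hlen : 2 ≤ (cycList I).length := by simpa [cycList] using ⟨k, hk⟩
  exact (List.formPerm_apply_mem_ne_self_iff _ ((pairwise_lt_cycList I).imp ne_of_lt) _ hmem).2
    hlen h

theorem weaklyRaising_iff_exists_cyc {π : Equiv.Perm (Fin (n + 1))} :
    WeaklyRaising π ↔ ∃ I : Finset (Fin n), π = cyc I := by
  constructor
  · intro hπ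
    refine ⟨univ.filter fun k => π k.castSucc ≠ k.castSucc,
      hπ.eq_of_fixed_iff (weaklyRaising_cyc _) fun k hk => ?_⟩
    obtain ⟨j, rfl⟩ := Fin.exists_castSucc_eq.2 hk
    simp [cyc_castSucc_eq_self_iff]
  · rintro ⟨I, rfl⟩
    exact weaklyRaising_cyc I

theorem cyc_empty : cyc (∅ : Finset (Fin n)) = 1 := by
  simp [cyc]

theorem cyc_max' (I : Finset (Fin n)) (hI : I.Nonempty) :
    cyc I (I.max' hI).castSucc = Fin.last n := by
  have hne : cyc I (I.max' hI).castSucc ≠ (I.max' hI).castSucc :=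
    fun h => (cyc_castSucc_eq_self_iff I _).1 h (I.max'_mem hI)
  have hlt := (weaklyRaising_cyc I _ (Fin.castSucc_ne_last _)).lt_of_ne hne.symm
  by_contra hlast
  obtain ⟨j, hj⟩ := Fin.exists_castSucc_eq.2 hlast
  rw [← hj, Fin.castSucc_lt_castSucc_iff] at hlt
  have hfix := (cyc_castSucc_eq_self_iff I j).2 fun hjI => hlt.not_ge (I.le_max' j hjI)
  rw [hj] at hfix
  exact hne ((cyc I).injective hfix)

theorem cyc_symm_last (I : Finset (Fin n)) (hI : I.Nonempty) :
    (cyc I).symm (Fin.last n) = (I.max' hI).castSucc :=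
  (Equiv.symm_apply_eq _).2 (cyc_max' I hI).symm

theorem cyc_eq_one_of_apply_last {I : Finset (Fin n)} (h : cyc I (Fin.last n) = Fin.last n) :
    cyc I = 1 := by
  rcases I.eq_empty_or_nonempty with rfl | hI
  · exact cyc_empty
  · exact absurd ((cyc I).injective ((cyc_max' I hI).trans h.symm)) (Fin.castSucc_ne_last _)

theorem cyc_ne_one {I : Finset (Fin n)} (hI : I.Nonempty) : cyc I ≠ 1 := by
  intro h
  have hmax := cyc_max' I hI
  rw [h, Equiv.Perm.one_apply] at hmax
  exact Fin.castSucc_ne_last _ hmax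

/-! ### The classification -/

section Alternatives

variable {ε : Fin (n + 1) → ℤˣ} {π : Equiv.Perm (Fin (n + 1))}

/-- The alternative `u = -1`, which lies in the Weyl group in even rank only. -/
def AltNeg (ε : Fin (n + 1) → ℤˣ) (π : Equiv.Perm (Fin (n + 1))) : Prop :=
  π = 1 ∧ ∀ j, ε j = -1

theorem eq_signsAt_iff (m : Fin (n + 1)) :
    ε = signsAt m ↔ ε m = 1 ∧ ∀ j, j ≠ m → ε j = -1 := by
  constructor
  · rintro rfl
    exact ⟨by simp [signsAt], fun j hj => by simp [signsAt, hj]⟩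
  · rintro ⟨hpos, hneg⟩
    funext j
    by_cases hj : j = m
    · simp [signsAt, hj, hpos]
    · simp [signsAt, hj, hneg j hj]

theorem eq_signsAt_last_iff :
    ε = signsAt (Fin.last n) ↔ (∀ j : Fin n, ε j.castSucc = -1) ∧ ε (Fin.last n) = 1 := by
  simp [eq_signsAt_iff, Fin.forall_fin_succ', Fin.castSucc_ne_last, and_comm]

theorem signsAt_injective : Function.Injective (signsAt (n := n)) := by
  intro a b h
  by_contra hab
  simpa [signsAt, hab] using congrFun h a

theorem altW_iff : AltW ε π ↔ π = 1 ∧ ε = signsAt (Fin.last n) := by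
  rw [AltW, eq_signsAt_last_iff]

theorem altC_iff {I : Finset (Fin n)} : AltC ε π I ↔ π = cyc I ∧ ε = signsAt (Fin.last n) := by
  rw [AltC, eq_signsAt_last_iff]

theorem altD_iff {I : Finset (Fin n)} {hI : I.Nonempty} :
    AltD ε π I hI ↔ π = cyc I ∧ ε = signsAt (I.max' hI).castSucc := by
  rw [AltD, eq_signsAt_iff]

theorem weaklyRaising_and_signs_iff :
    (WeaklyRaising π ∧ (ε = signsAt (Fin.last n) ∨ ε = signsAt (π.symm (Fin.last n)))) ↔
      AltW ε π ∨ (∃ I : Finset (Fin n), I.Nonempty ∧ AltC ε π I) ∨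
        ∃ (I : Finset (Fin n)) (hI : I.Nonempty), AltD ε π I hI := by
  simp only [altW_iff, altC_iff, altD_iff]
  constructor
  · rintro ⟨hπ, hε⟩
    obtain ⟨I, rfl⟩ := weaklyRaising_iff_exists_cyc.1 hπ
    rcases I.eq_empty_or_nonempty with rfl | hI
    · exact Or.inl ⟨cyc_empty, by simpa [cyc_empty, ← Equiv.Perm.inv_def] using hε⟩
    · rw [cyc_symm_last I hI] at hε
      exact Or.inr (hε.imp (fun h => ⟨I, hI, rfl, h⟩) fun h => ⟨I, hI, rfl, h⟩)
  · rintro (⟨rfl, h⟩ | ⟨I, -, rfl, h⟩ | ⟨I, hI, rfl, h⟩)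
    · exact ⟨fun k _ => le_rfl, Or.inl h⟩
    · exact ⟨weaklyRaising_cyc I, Or.inl h⟩
    · exact ⟨weaklyRaising_cyc I, Or.inr (by rw [h, cyc_symm_last I hI])⟩

theorem NuVanishes.eq_signsAt_last (hu : NuVanishes (signedPerm ε π))
    (hl : ε (Fin.last n) = 1) : ε = signsAt (Fin.last n) ∧ WeaklyRaising π := by
  have hneg : ∀ k, k ≠ Fin.last n → ε k = -1 := fun k => hu.eq_neg_one_of_ne_last (Or.inl hl)
  exact ⟨(eq_signsAt_iff _).2 ⟨hl, hneg⟩, fun k hk => hu.le_apply_of_neg fun j hj =>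
    hneg j (hj.trans_lt (Fin.lt_last_iff_ne_last.2 hk)).ne⟩

theorem NuVanishes.altNeg (hu : NuVanishes (signedPerm ε π)) (hl : ε (Fin.last n) = -1)
    (hπl : π (Fin.last n) = Fin.last n) : AltNeg ε π := by
  have hneg : ∀ k, ε k = -1 := fun k =>
    (eq_or_ne k (Fin.last n)).elim (· ▸ hl) (hu.eq_neg_one_of_ne_last (Or.inr hπl))
  obtain ⟨I, rfl⟩ :=
    weaklyRaising_iff_exists_cyc.1 fun k _ => hu.le_apply_of_neg fun j _ => hneg j
  exact ⟨cyc_eq_one_of_apply_last hπl, hneg⟩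

theorem WeaklyRaising.nuVanishes (hπ : WeaklyRaising π) :
    NuVanishes (signedPerm (signsAt (Fin.last n)) π) :=
  nuVanishes_signedPerm (fun k hk => by simp [signsAt, hk]) fun k hk =>
    hπ k fun hl => by simp [signsAt, hl] at hk

theorem nuVanishes_signedPerm_iff :
    NuVanishes (signedPerm ε π) ↔ AltNeg ε π ∨
      WeaklyRaising π ∧ (ε = signsAt (Fin.last n) ∨ ε = signsAt (π.symm (Fin.last n))) := by
  constructor
  · intro hu
    rcases Int.units_eq_one_or (ε (Fin.last n)) with hl | hl
    · obtain ⟨hε, hπ⟩ := hu.eq_signsAt_last hl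
      exact Or.inr ⟨hπ, Or.inl hε⟩
    by_cases hπl : π (Fin.last n) = Fin.last n
    · exact Or.inl (hu.altNeg hl hπl)
    · obtain ⟨hε, hπ⟩ := (nuVanishes_flipSigns_iff.2 hu).eq_signsAt_last
        (by simp [flipSigns, lastSign, hπl, hl])
      rw [(flipSigns_involutive π).eq_iff, flipSigns_signsAt_last] at hε
      exact Or.inr ⟨hπ, Or.inr hε⟩
  · rintro (⟨rfl, hneg⟩ | ⟨hπ, rfl | rfl⟩)
    · exact nuVanishes_signedPerm (fun k _ => hneg k) fun k _ => le_rfl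
    · exact hπ.nuVanishes
    · rw [← flipSigns_signsAt_last, nuVanishes_flipSigns_iff]
      exact hπ.nuVanishes

theorem eq_signedPerm {u : V n ≃ₗ[ℝ] V n} (hu : ∀ j, u (e j) = ε j • e (π j)) :
    u = signedPerm ε π := by
  refine LinearEquiv.toLinearMap_injective ((Pi.basisFun ℝ (Fin (n + 1))).ext fun j => ?_)
  rw [Pi.basisFun_apply]
  exact (hu j).trans (signedPerm_e ε π j).symm

theorem sum_signedPerm_e (j : Fin (n + 1)) : ∑ t, signedPerm ε π (e j) t = ((ε j : ℤ) : ℝ) := by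
  rw [signedPerm_e]
  simp [Units.smul_def, ← mul_sum, sum_e]

theorem signs_eq_of_signedPerm_eq {δ : Fin (n + 1) → ℤˣ} {σ : Equiv.Perm (Fin (n + 1))}
    (h : signedPerm ε π = signedPerm δ σ) : ε = δ := by
  funext j
  have hj : ((ε j : ℤ) : ℝ) = (δ j : ℤ) := by rw [← sum_signedPerm_e, h, sum_signedPerm_e]
  exact_mod_cast hj

theorem signedPerm_mem_weylGroup_iff :
    signedPerm ε π ∈ weylGroup n ↔ Even #{j | ε j = -1} := by
  refine ⟨?_, fun h => ⟨ε, π, h, rfl⟩⟩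
  rintro ⟨δ, σ, heven, h⟩
  rwa [signs_eq_of_signedPerm_eq h]

theorem not_altNeg_of_odd (hodd : Odd (n + 1)) (h : signedPerm ε π ∈ weylGroup n) :
    ¬ AltNeg ε π := by
  rintro ⟨-, hneg⟩
  rw [signedPerm_mem_weylGroup_iff, filter_true_of_mem fun j _ => hneg j, card_univ,
    Fintype.card_fin] at h
  exact Nat.not_even_iff_odd.2 hodd h

theorem signedPerm_neg_one : signedPerm (fun _ : Fin (n + 1) => -1) 1 = LinearEquiv.neg ℝ := by
  ext x i
  simp [signedPerm, Equiv.Perm.one_def]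

end Alternatives

end TypeD

theorem proposition9p1_general (n : ℕ) (u : TypeD.weylGroup n) (ε : Fin (n + 1) → ℤˣ)
    (π : Equiv.Perm (Fin (n + 1))) (hu : ∀ j, u.1 (TypeD.e j) = ε j • TypeD.e (π j)) :
    (TypeD.IsRational u ↔
      TypeD.AltNeg ε π ∨
      TypeD.AltW ε π ∨
      (∃ I : Finset (Fin n), I.Nonempty ∧ TypeD.AltC ε π I) ∨
      (∃ (I : Finset (Fin n)) (hI : I.Nonempty), TypeD.AltD ε π I hI)) ∧
    ¬ (TypeD.AltNeg ε π ∧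
      (TypeD.AltW ε π ∨
      (∃ I : Finset (Fin n), I.Nonempty ∧ TypeD.AltC ε π I) ∨
      (∃ (I : Finset (Fin n)) (hI : I.Nonempty), TypeD.AltD ε π I hI))) ∧
    (TypeD.AltNeg ε π → u.1 = LinearEquiv.neg ℝ) ∧
    ¬ (TypeD.AltW ε π ∧ ∃ I : Finset (Fin n), I.Nonempty ∧ TypeD.AltC ε π I) ∧
    ¬ (TypeD.AltW ε π ∧ ∃ (I : Finset (Fin n)) (hI : I.Nonempty), TypeD.AltD ε π I hI) ∧
    ¬ ((∃ I : Finset (Fin n), I.Nonempty ∧ TypeD.AltC ε π I) ∧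
        ∃ (I : Finset (Fin n)) (hI : I.Nonempty), TypeD.AltD ε π I hI) ∧
    (TypeD.AltW ε π → u.1 = TypeD.w0 n) ∧
    (∀ I : Finset (Fin n), I.Nonempty → TypeD.AltC ε π I → u.1 = TypeD.cElt I) ∧
    (∀ (I : Finset (Fin n)) (hI : I.Nonempty), TypeD.AltD ε π I hI → u.1 = TypeD.dElt I hI) := by
  rw [TypeD.isRational_iff_nuVanishes, TypeD.eq_signedPerm hu, TypeD.nuVanishes_signedPerm_iff,
    TypeD.weaklyRaising_and_signs_iff]
  refine ⟨Iff.rfl, ?_, ?_, ?_⟩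
  · rintro ⟨⟨-, hneg⟩, ⟨-, -, hpos⟩ | ⟨I, -, -, -, hpos⟩ | ⟨I, hI, -, hpos, -⟩⟩ <;>
      simp [hneg] at hpos
  · rintro ⟨rfl, hneg⟩
    rw [funext hneg, TypeD.signedPerm_neg_one]
  simp only [TypeD.altW_iff, TypeD.altC_iff, TypeD.altD_iff]
  refine ⟨?_, ?_, ?_, ?_, ?_, ?_⟩
  · rintro ⟨⟨rfl, -⟩, I, hI, h, -⟩
    exact TypeD.cyc_ne_one hI h.symm
  · rintro ⟨⟨rfl, -⟩, I, hI, h, -⟩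
    exact TypeD.cyc_ne_one hI h.symm
  · rintro ⟨⟨_, -, -, rfl⟩, I, hI, -, h⟩
    exact Fin.castSucc_ne_last _ (TypeD.signsAt_injective h).symm
  · rintro ⟨rfl, rfl⟩
    rfl
  · rintro I - ⟨rfl, rfl⟩
    rfl
  · rintro I hI ⟨rfl, rfl⟩
    rfl

theorem proposition9p1 (n : ℕ) (hr : 5 ≤ n + 1) (hodd : Odd (n + 1))
    (u : TypeD.weylGroup n) (ε : Fin (n + 1) → ℤˣ) (π : Equiv.Perm (Fin (n + 1)))
    (hu : ∀ j, u.1 (TypeD.e j) = ε j • TypeD.e (π j)) :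
    -- the criterion
    (TypeD.IsRational u ↔
      TypeD.AltW ε π ∨
      (∃ I : Finset (Fin n), I.Nonempty ∧ TypeD.AltC ε π I) ∨
      (∃ (I : Finset (Fin n)) (hI : I.Nonempty), TypeD.AltD ε π I hI)) ∧
    -- the alternatives are mutually exclusive
    ¬ (TypeD.AltW ε π ∧ ∃ I : Finset (Fin n), I.Nonempty ∧ TypeD.AltC ε π I) ∧
    ¬ (TypeD.AltW ε π ∧ ∃ (I : Finset (Fin n)) (hI : I.Nonempty), TypeD.AltD ε π I hI) ∧
    ¬ ((∃ I : Finset (Fin n), I.Nonempty ∧ TypeD.AltC ε π I) ∧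
        ∃ (I : Finset (Fin n)) (hI : I.Nonempty), TypeD.AltD ε π I hI) ∧
    -- the elements that they describe
    (TypeD.AltW ε π → u.1 = TypeD.w0 n) ∧
    (∀ I : Finset (Fin n), I.Nonempty → TypeD.AltC ε π I → u.1 = TypeD.cElt I) ∧
    (∀ (I : Finset (Fin n)) (hI : I.Nonempty), TypeD.AltD ε π I hI → u.1 = TypeD.dElt I hI) := by
  have hneg := TypeD.not_altNeg_of_odd hodd (TypeD.eq_signedPerm hu ▸ u.2)
  obtain ⟨hiff, -, -, hrest⟩ := proposition9p1_general n u ε π hu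
  exact ⟨hiff.trans (or_iff_right hneg), hrest⟩
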